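/- Let $k$ be an arbitrary field, and let $H$ be a finite group acting by automorphisms on a (discrete) group $\Gamma$. The smash coproduct $k[\Gamma]\rtimes k^H$ is the Hopf algebra which is $k[\Gamma]\otimes k^H$ as an algebra (write $r\#f$ for $r\otimes f$, and $\delta_h\in k^H$ for the indicator function of $h$), with $$\Delta(r\#\delta_h)=\sum_{l\in H}(r\#\delta_{l^{-1}})\otimes (l.r\#\delta_{lh}),\qquad \varepsilon(r\#\delta_h)=\delta_{h,1},\qquad S(r\#\delta_h)=h^{-1}.r^{-1}\#\delta_{h^{-1}}\qquad (r\in\Gamma,\ h\in H).$$ A quotient datum for the action of $H$ on $\Gamma$ is a triple $(G,N,\Phi)$ where $G\subset H$ is a subgroup, $N\triangleleft\Gamma$ is a normal and $G$-stable subgroup, and $\Phi:N\to (k^G)^\times$ is a group morphism such that $$\Phi(r)(lh)=\Phi(l^{-1}.r)(h)\,\Phi(r)(l),\qquad \Phi(r)=\Phi(srs^{-1})\qquad (r\in N,\ s\in\Gamma,\ h,l\in G).$$ Given such a datum, let $G$ act on $\Gamma/N$ by the induced action and choose a section $j:\Gamma/N\to\Gamma$ of the canonical projection with $j(1)=1$.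 Then $k[\Gamma/N]\rtimes_\Phi k^G$ denotes the vector space $k[\Gamma/N]\otimes k^G$ with unit $1\#1$, counit $\varepsilon(x\#\delta_h)=\delta_{h,1}$, and $$(x\#\delta_h)(y\#\delta_g)=xy\#\delta_h\delta_g\,\Phi\big(j(x)j(y)j(xy)^{-1}\big),$$ $$\Delta(x\#\delta_h)=\sum_{l\in G}(x\#\delta_{l^{-1}})\otimes\big(l.x\#\delta_{lh}\,\Phi(l.j(x)\,j(l.x)^{-1})\big),$$ $$S(x\#\delta_h)=h^{-1}.x^{-1}\#\Phi\big(j(h^{-1}.x^{-1})^{-1}\;h^{-1}.j(x)^{-1}\big)\,\delta_{h^{-1}}$$ for $x,y\in\Gamma/N$ and $h,g\in G$; this is a Hopf algebra, which up to isomorphism does not depend on $j$. Theorem. Let $L$ be a Hopf algebra quotient of $k[\Gamma]\rtimes k^H$, that is, a Hopf algebra over $k$ with a surjective Hopf algebra map $k[\Gamma]\rtimes k^H\to L$. Then there exists a quotient datum $(G,N,\Phi)$ for the action of $H$ on $\Gamma$ such that, for every choice of the section $j$, $L$ is isomorphic as a Hopf algebra to $k[\Gamma/N]\rtimes_\Phi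 k^G$. -/

import Mathlib

open scoped TensorProduct

noncomputable section

/-! ### Verifying the Hopf algebra axioms on a basis

Throughout this part `b` is a basis of `A` indexed by `Q × G`, and the structure maps send basis
vectors to combinations of basis vectors with scalar coefficients `σ`, `τ`, `s`. These are only
auxiliary facts for the two constructions below. -/

namespace MonomialHopf

/-- The scalar identities that make a monomial structure on a basis indexed by `Q × G` a Hopf
algebra. -/
structure Compat {k Q G : Type*} [Field k] [Group Q] [Group G] (act : G → Q →* Q)
    (σ : Q → Q → G → k) (τ : G → Q → G → k) (s : Q → G → k) : Prop where
  one_smul : ∀ x, act 1 x = x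
  mul_smul : ∀ p m x, act (p * m) x = act p (act m x)
  assoc : ∀ x y z h, σ x y h * σ (x * y) z h = σ y z h * σ x (y * z) h
  one_left : ∀ x h, σ 1 x h = 1
  one_right : ∀ x h, σ x 1 h = 1
  coassoc : ∀ p m x h, τ (p * m) x (p * m * h) * τ m x p⁻¹ =
    τ m x (m * h) * τ p (act m x) (p * m * h)
  one_act : ∀ x h, τ 1 x h = 1
  eval_one : ∀ l x, τ l x 1 = 1
  act_one : ∀ l h, τ l 1 h = 1
  mul_eval_one : ∀ x y, σ x y 1 = 1
  compat : ∀ l x y h, σ x y h * τ l (x * y) (l * h) =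
    τ l x (l * h) * τ l y (l * h) * (σ x y l⁻¹ * σ (act l x) (act l y) (l * h))
  antipode_left : ∀ l x, τ l x l * s x l⁻¹ * σ (act l x⁻¹) (act l x) l = 1
  antipode_right : ∀ l x, τ l x l * s (act l x) l * σ x x⁻¹ l⁻¹ = 1

theorem basis_induction {k ι A : Type*} [Field k] [AddCommGroup A] [Module k A]
    (b : Module.Basis ι k A) {p : A → Prop} (hb : ∀ i, p (b i)) (h0 : p 0)
    (ha : ∀ x y, p x → p y → p (x + y)) (hs : ∀ (c : k) x, p x → p (c • x)) (a : A) : p a := by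
  refine Submodule.span_induction (p := fun x _ => p x) ?_ h0 (fun x y _ _ => ha x y)
    (fun c x _ => hs c x) (b.mem_span a)
  rintro _ ⟨i, rfl⟩
  exact hb i

section Ring

variable {k Q G A : Type*} [Field k] [Group Q] [Group G] [Fintype G] [DecidableEq G]
  [AddCommGroup A] [Module k A] (b : Module.Basis (Q × G) k A)
  {act : G → Q →* Q} {σ : Q → Q → G → k} {τ : G → Q → G → k} {s : Q → G → k}

theorem mul_assoc_of_compat (H : Compat act σ τ s) (μ : A →ₗ[k] A →ₗ[k] A)
    (hμ : ∀ x h y g, μ (b (x, h)) (b (y, g)) = if h = g then σ x y h • b (x * y, h) else 0)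
    (u v w : A) : μ (μ u v) w = μ u (μ v w) := by
  induction u using basis_induction b with
  | h0 => simp
  | ha x y hx hy => simp [hx, hy]
  | hs c x hx => simp [hx]
  | hb i =>
  induction v using basis_induction b with
  | h0 => simp
  | ha x y hx hy => simp [hx, hy]
  | hs c x hx => simp [hx]
  | hb j =>
  induction w using basis_induction b with
  | h0 => simp
  | ha x y hx hy => simp [hx, hy]
  | hs c x hx => simp [hx]
  | hb l =>
  obtain ⟨x, h⟩ := i
  obtain ⟨y, g⟩ := j
  obtain ⟨z, f⟩ := l
  by_cases h1 : h = g <;> by_cases h2 : g = f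
  · subst h1; subst h2
    simp [hμ, smul_smul, H.assoc, _root_.mul_assoc]
  · subst h1
    simp [hμ, h2]
  · subst h2
    simp [hμ, h1]
  · simp [hμ, h1, h2]

theorem one_mul_of_compat (H : Compat act σ τ s) (μ : A →ₗ[k] A →ₗ[k] A)
    (hμ : ∀ x h y g, μ (b (x, h)) (b (y, g)) = if h = g then σ x y h • b (x * y, h) else 0)
    (e : A) (he : e = ∑ h, b (1, h)) (u : A) : μ e u = u := by
  induction u using basis_induction b with
  | h0 => simp
  | ha x y hx hy => simp [hx, hy]
  | hs c x hx => simp [hx]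
  | hb i =>
  obtain ⟨x, h⟩ := i
  simp [he, hμ, H.one_left]

theorem mul_one_of_compat (H : Compat act σ τ s) (μ : A →ₗ[k] A →ₗ[k] A)
    (hμ : ∀ x h y g, μ (b (x, h)) (b (y, g)) = if h = g then σ x y h • b (x * y, h) else 0)
    (e : A) (he : e = ∑ h, b (1, h)) (u : A) : μ u e = u := by
  induction u using basis_induction b with
  | h0 => simp
  | ha x y hx hy => simp [hx, hy]
  | hs c x hx => simp [hx]
  | hb i =>
  obtain ⟨x, h⟩ := i
  simp [he, hμ, H.one_right]

end Ring

section Hopf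

variable {k Q G A : Type*} [Field k] [Group Q] [Group G] [Fintype G] [DecidableEq G]
  [Ring A] [Algebra k A] (b : Module.Basis (Q × G) k A)
  {act : G → Q →* Q} {σ : Q → Q → G → k} {τ : G → Q → G → k} {s : Q → G → k}

theorem coassoc_of_compat (H : Compat act σ τ s) (Δ : A →ₗ[k] A ⊗[k] A)
    (hΔ : ∀ x h, Δ (b (x, h)) =
      ∑ l, b (x, l⁻¹) ⊗ₜ[k] (τ l x (l * h) • b (act l x, l * h))) :
    (TensorProduct.assoc k A A A).toLinearMap ∘ₗ Δ.rTensor A ∘ₗ Δ = Δ.lTensor A ∘ₗ Δ := by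
  refine b.ext fun ⟨x, h⟩ => ?_
  simp only [LinearMap.comp_apply, hΔ, map_sum, LinearMap.rTensor_tmul, LinearMap.lTensor_tmul,
    map_smul, TensorProduct.sum_tmul, TensorProduct.tmul_sum, LinearEquiv.coe_coe,
    TensorProduct.assoc_tmul, TensorProduct.tmul_smul, ← TensorProduct.smul_tmul',
    Finset.smul_sum, smul_smul]
  rw [Finset.sum_comm]
  refine Finset.sum_congr rfl fun m _ => ?_
  rw [← Equiv.sum_comp (Equiv.mulRight m)]
  refine Finset.sum_congr rfl fun p _ => ?_
  have := H.coassoc p m x h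
  simp only [Equiv.coe_mulRight, mul_inv_rev, mul_inv_cancel_left, H.mul_smul, mul_assoc] at *
  rw [this]

theorem rTensor_of_compat (H : Compat act σ τ s) (Δ : A →ₗ[k] A ⊗[k] A) (ε : A →ₗ[k] k)
    (hΔ : ∀ x h, Δ (b (x, h)) =
      ∑ l, b (x, l⁻¹) ⊗ₜ[k] (τ l x (l * h) • b (act l x, l * h)))
    (hε : ∀ x h, ε (b (x, h)) = if h = 1 then 1 else 0) :
    ε.rTensor A ∘ₗ Δ = TensorProduct.mk k _ _ 1 := by
  refine b.ext fun ⟨x, h⟩ => ?_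
  simp only [LinearMap.comp_apply, hΔ, map_sum, LinearMap.rTensor_tmul, hε]
  rw [Finset.sum_eq_single 1]
  · simp [H.one_act, H.one_smul]
  · intro l _ hl
    simp [hl]
  · simp

theorem lTensor_of_compat (H : Compat act σ τ s) (Δ : A →ₗ[k] A ⊗[k] A) (ε : A →ₗ[k] k)
    (hΔ : ∀ x h, Δ (b (x, h)) =
      ∑ l, b (x, l⁻¹) ⊗ₜ[k] (τ l x (l * h) • b (act l x, l * h)))
    (hε : ∀ x h, ε (b (x, h)) = if h = 1 then 1 else 0) :
    ε.lTensor A ∘ₗ Δ = (TensorProduct.mk k _ _).flip 1 := by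
  refine b.ext fun ⟨x, h⟩ => ?_
  simp only [LinearMap.comp_apply, hΔ, map_sum, LinearMap.lTensor_tmul, map_smul, hε]
  rw [Finset.sum_eq_single h⁻¹]
  · simp [H.eval_one]
  · intro l _ hl
    have : l * h ≠ 1 := fun h' => hl (eq_inv_of_mul_eq_one_left h')
    simp [this]
  · simp

theorem counit_mul_of_compat (H : Compat act σ τ s) (ε : A →ₗ[k] k)
    (hmul : ∀ x h y g, b (x, h) * b (y, g) = if h = g then σ x y h • b (x * y, h) else 0)
    (hε : ∀ x h, ε (b (x, h)) = if h = 1 then 1 else 0) (u v : A) :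
    ε (u * v) = ε u * ε v := by
  induction u using basis_induction b with
  | h0 => simp
  | ha x y hx hy => simp [hx, hy, add_mul]
  | hs c x hx => simp [hx, mul_assoc]
  | hb i =>
  induction v using basis_induction b with
  | h0 => simp
  | ha x y hx hy => simp [hx, hy, mul_add]
  | hs c x hx => simp [hx, mul_left_comm]
  | hb j =>
  obtain ⟨x, h⟩ := i
  obtain ⟨y, g⟩ := j
  by_cases h1 : h = g
  · subst h1
    by_cases h2 : h = 1
    · subst h2
      simp [hmul, hε, H.mul_eval_one]
    · simp [hmul, hε, h2]
  · by_cases h2 : h = 1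
    · subst h2
      simp [hmul, hε, h1, Ne.symm h1]
    · simp [hmul, hε, h1, h2]

theorem comul_one_of_compat (H : Compat act σ τ s) (Δ : A →ₗ[k] A ⊗[k] A)
    (hone : (1 : A) = ∑ h, b (1, h))
    (hΔ : ∀ x h, Δ (b (x, h)) =
      ∑ l, b (x, l⁻¹) ⊗ₜ[k] (τ l x (l * h) • b (act l x, l * h))) :
    Δ 1 = 1 := by
  rw [Algebra.TensorProduct.one_def, hone, map_sum, TensorProduct.sum_tmul]
  simp only [hΔ, H.act_one, one_smul, map_one]
  rw [Finset.sum_comm, ← Equiv.sum_comp (Equiv.inv G)]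
  refine Finset.sum_congr rfl fun l _ => ?_
  rw [TensorProduct.tmul_sum, ← Equiv.sum_comp (Equiv.mulLeft l)]
  simp

theorem comul_mul_of_compat (H : Compat act σ τ s) (Δ : A →ₗ[k] A ⊗[k] A)
    (hmul : ∀ x h y g, b (x, h) * b (y, g) = if h = g then σ x y h • b (x * y, h) else 0)
    (hΔ : ∀ x h, Δ (b (x, h)) =
      ∑ l, b (x, l⁻¹) ⊗ₜ[k] (τ l x (l * h) • b (act l x, l * h))) (u v : A) :
    Δ (u * v) = Δ u * Δ v := by
  induction u using basis_induction b with
  | h0 => simp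
  | ha x y hx hy => simp [hx, hy, add_mul]
  | hs c x hx => simp [hx]
  | hb i =>
  induction v using basis_induction b with
  | h0 => simp
  | ha x y hx hy => simp [hx, hy, mul_add]
  | hs c x hx => simp [hx]
  | hb j =>
  obtain ⟨x, h⟩ := i
  obtain ⟨y, g⟩ := j
  have expand : Δ (b (x, h)) * Δ (b (y, g)) =
      ∑ l, (b (x, l⁻¹) * b (y, l⁻¹)) ⊗ₜ[k] ((τ l x (l * h) • b (act l x, l * h)) *
        (τ l y (l * g) • b (act l y, l * g))) := by
    rw [hΔ, hΔ, Finset.sum_mul_sum]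
    refine Finset.sum_congr rfl fun l _ => ?_
    rw [Finset.sum_eq_single l]
    · simp only [Algebra.TensorProduct.tmul_mul_tmul]
    · intro m _ hm
      simp [Algebra.TensorProduct.tmul_mul_tmul, hmul, Ne.symm hm]
    · simp
  rw [expand]
  by_cases h1 : h = g
  · subst h1
    simp only [hmul, if_true, map_smul, hΔ, Finset.smul_sum]
    refine Finset.sum_congr rfl fun l _ => ?_
    simp only [smul_mul_smul_comm, hmul, if_true, smul_smul, TensorProduct.tmul_smul,
      ← TensorProduct.smul_tmul', map_mul, H.compat]
    congr 1
    ring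
  · simp [hmul, h1]

theorem antipode_left_of_compat (H : Compat act σ τ s) (Δ : A →ₗ[k] A ⊗[k] A) (ε : A →ₗ[k] k)
    (S : A →ₗ[k] A) (hone : (1 : A) = ∑ h, b (1, h))
    (hmul : ∀ x h y g, b (x, h) * b (y, g) = if h = g then σ x y h • b (x * y, h) else 0)
    (hΔ : ∀ x h, Δ (b (x, h)) =
      ∑ l, b (x, l⁻¹) ⊗ₜ[k] (τ l x (l * h) • b (act l x, l * h)))
    (hε : ∀ x h, ε (b (x, h)) = if h = 1 then 1 else 0)
    (hS : ∀ x h, S (b (x, h)) = s x h • b (act h⁻¹ x⁻¹, h⁻¹)) :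
    LinearMap.mul' k A ∘ₗ S.rTensor A ∘ₗ Δ = Algebra.linearMap k A ∘ₗ ε := by
  refine b.ext fun ⟨x, h⟩ => ?_
  by_cases h1 : h = 1
  · subst h1
    simp only [LinearMap.comp_apply, hΔ, hε, map_sum, LinearMap.rTensor_tmul, hS,
      LinearMap.mul'_apply, smul_mul_smul_comm, hmul, if_true, mul_one, inv_inv, smul_smul,
      Algebra.linearMap_apply, map_one, hone]
    refine Finset.sum_congr rfl fun l _ => ?_
    rw [← map_mul, inv_mul_cancel, map_one, mul_comm (s x l⁻¹), H.antipode_left, one_smul]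
  · simp [hΔ, hε, hS, hmul, h1]

theorem antipode_right_of_compat (H : Compat act σ τ s) (Δ : A →ₗ[k] A ⊗[k] A) (ε : A →ₗ[k] k)
    (S : A →ₗ[k] A) (hone : (1 : A) = ∑ h, b (1, h))
    (hmul : ∀ x h y g, b (x, h) * b (y, g) = if h = g then σ x y h • b (x * y, h) else 0)
    (hΔ : ∀ x h, Δ (b (x, h)) =
      ∑ l, b (x, l⁻¹) ⊗ₜ[k] (τ l x (l * h) • b (act l x, l * h)))
    (hε : ∀ x h, ε (b (x, h)) = if h = 1 then 1 else 0)
    (hS : ∀ x h, S (b (x, h)) = s x h • b (act h⁻¹ x⁻¹, h⁻¹)) :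
    LinearMap.mul' k A ∘ₗ S.lTensor A ∘ₗ Δ = Algebra.linearMap k A ∘ₗ ε := by
  refine b.ext fun ⟨x, h⟩ => ?_
  by_cases h1 : h = 1
  · subst h1
    simp only [LinearMap.comp_apply, hΔ, hε, map_sum, LinearMap.lTensor_tmul, hS, map_smul,
      LinearMap.mul'_apply, mul_smul_comm, hmul, if_true, mul_one, smul_smul,
      Algebra.linearMap_apply, map_one, hone]
    rw [← Equiv.sum_comp (Equiv.inv G) (fun h => b (1, h))]
    refine Finset.sum_congr rfl fun l _ => ?_
    rw [map_inv, ← H.mul_smul, inv_mul_cancel, H.one_smul, mul_inv_cancel,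
      H.antipode_right, one_smul, Equiv.inv_apply]
  · simp [hΔ, hε, hS, hmul, h1]

end Hopf

end MonomialHopf

/-! ### The smash coproduct -/

section SmashCoproduct

attribute [local instance] Fintype.ofFinite Classical.decEq

/-- The underlying algebra of the smash coproduct `k[Γ] ⋊ k^H` is the tensor product algebra
`k[Γ] ⊗ k^H`. A type synonym is used since its coalgebra structure is not that of the tensor
product. -/
def SmashCoproduct (k Γ H : Type*) [Field k] [Group Γ] [Group H] : Type _ :=
  MonoidAlgebra k Γ ⊗[k] (H → k)

namespace SmashCoproduct

variable (k Γ H : Type*) [Field k] [Group Γ] [Group H]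

instance : Ring (SmashCoproduct k Γ H) :=
  inferInstanceAs (Ring (MonoidAlgebra k Γ ⊗[k] (H → k)))

instance : Algebra k (SmashCoproduct k Γ H) :=
  inferInstanceAs (Algebra k (MonoidAlgebra k Γ ⊗[k] (H → k)))

variable {k Γ H}

/-- The element `r # f = r ⊗ f`, for `r ∈ Γ` and `f ∈ k^H`. -/
def elt (r : Γ) (f : H → k) : SmashCoproduct k Γ H :=
  (MonoidAlgebra.single r (1 : k) ⊗ₜ[k] f : MonoidAlgebra k Γ ⊗[k] (H → k))

/-- The function `δ_h`. -/
def delta (h : H) : H → k := Pi.single h 1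

variable (k Γ H) in
/-- The basis `(r # δ_h)` of `k[Γ] ⋊ k^H`. -/
def basis [Finite H] : Module.Basis (Γ × H) k (SmashCoproduct k Γ H) :=
  (MonoidAlgebra.basis Γ k).tensorProduct (Pi.basisFun k H)

theorem basis_apply [Finite H] (r : Γ) (h : H) :
    basis k Γ H (r, h) = elt r (delta h) := by
  refine (Module.Basis.tensorProduct_apply _ _ _ _).trans ?_
  rw [MonoidAlgebra.basis_apply, Pi.basisFun_apply]
  unfold elt delta
  congr!

variable [Finite H] [MulDistribMulAction H Γ]

variable (k Γ H) in
/-- `Δ(r # δ_h) = ∑_l (r # δ_{l⁻¹}) ⊗ (l.r # δ_{lh})`. -/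
def comul : SmashCoproduct k Γ H →ₗ[k] SmashCoproduct k Γ H ⊗[k] SmashCoproduct k Γ H :=
  (basis k Γ H).constr k fun p =>
    ∑ l : H, elt p.1 (delta l⁻¹) ⊗ₜ[k] elt (l • p.1) (delta (l * p.2))

variable (k Γ H) in
/-- `ε(r # δ_h) = δ_{h,1}`. -/
def counit : SmashCoproduct k Γ H →ₗ[k] k :=
  (basis k Γ H).constr k fun p => if p.2 = 1 then 1 else 0

variable (k Γ H) in
/-- `S(r # δ_h) = h⁻¹.r⁻¹ # δ_{h⁻¹}`. -/
def antipode : SmashCoproduct k Γ H →ₗ[k] SmashCoproduct k Γ H :=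
  (basis k Γ H).constr k fun p => elt (p.2⁻¹ • p.1⁻¹) (delta p.2⁻¹)

theorem compat : MonomialHopf.Compat (k := k) (fun h : H => MulDistribMulAction.toMonoidHom Γ h)
    (fun _ _ _ => 1) (fun _ _ _ => 1) (fun _ _ => 1) := by
  constructor <;> simp [mul_smul]

theorem basis_mul (x : Γ) (h : H) (y : Γ) (g : H) :
    basis k Γ H (x, h) * basis k Γ H (y, g) =
      if h = g then (1 : k) • basis k Γ H (x * y, h) else 0 := by
  simp only [basis_apply, one_smul]
  refine (Algebra.TensorProduct.tmul_mul_tmul _ _ _ _).trans ?_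
  rw [MonoidAlgebra.single_mul_single, one_mul]
  by_cases hg : h = g
  · subst hg
    rw [if_pos rfl]
    unfold elt delta
    rw [← Pi.single_mul, one_mul]
  · rw [if_neg hg]
    have e : (delta h * delta g : H → k) = 0 := by
      unfold delta
      ext f
      by_cases hf : f = h
      · subst hf; simp [hg]
      · simp [hf]
    rw [e]
    exact TensorProduct.tmul_zero _ _

theorem one_eq_sum : (1 : SmashCoproduct k Γ H) = ∑ h, basis k Γ H (1, h) := by
  simp only [basis_apply]
  unfold elt delta
  refine Eq.trans ?_ (TensorProduct.tmul_sum _ _ _)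
  rw [Finset.univ_sum_single]
  rfl

theorem comul_basis (x : Γ) (h : H) : comul k Γ H (basis k Γ H (x, h)) =
    ∑ l : H, basis k Γ H (x, l⁻¹) ⊗ₜ[k] ((1 : k) •
      basis k Γ H (MulDistribMulAction.toMonoidHom Γ l x, l * h)) := by
  rw [comul, Module.Basis.constr_basis]
  simp [basis_apply]

theorem counit_basis (x : Γ) (h : H) :
    counit k Γ H (basis k Γ H (x, h)) = if h = 1 then 1 else 0 := by
  simp [counit, Module.Basis.constr_basis]

theorem antipode_basis (x : Γ) (h : H) : antipode k Γ H (basis k Γ H (x, h)) =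
    (1 : k) • basis k Γ H (MulDistribMulAction.toMonoidHom Γ h⁻¹ x⁻¹, h⁻¹) := by
  rw [antipode, Module.Basis.constr_basis]
  simp [basis_apply]

instance : Coalgebra k (SmashCoproduct k Γ H) where
  comul := comul k Γ H
  counit := counit k Γ H
  coassoc := MonomialHopf.coassoc_of_compat _ compat _ comul_basis
  rTensor_counit_comp_comul := by
    exact MonomialHopf.rTensor_of_compat _ compat _ _ comul_basis counit_basis
  lTensor_counit_comp_comul := by
    exact MonomialHopf.lTensor_of_compat _ compat _ _ comul_basis counit_basis

instance : Bialgebra k (SmashCoproduct k Γ H) :=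
  Bialgebra.mk' k _
    (by
      change counit k Γ H 1 = 1
      simp [one_eq_sum, counit_basis])
    (by
      exact MonomialHopf.counit_mul_of_compat _ compat _ basis_mul counit_basis _ _)
    (by
      exact MonomialHopf.comul_one_of_compat _ compat _ one_eq_sum comul_basis)
    (by
      exact MonomialHopf.comul_mul_of_compat _ compat _ basis_mul comul_basis _ _)

instance : HopfAlgebra k (SmashCoproduct k Γ H) where
  antipode := antipode k Γ H
  mul_antipode_rTensor_comul := by
    exact MonomialHopf.antipode_left_of_compat _ compat _ _ _ one_eq_sum basis_mul
      comul_basis counit_basis antipode_basis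
  mul_antipode_lTensor_comul := by
    exact MonomialHopf.antipode_right_of_compat _ compat _ _ _ one_eq_sum basis_mul
      comul_basis counit_basis antipode_basis

end SmashCoproduct

end SmashCoproduct

/-! ### Quotient data and the associated Hopf algebras -/

/-- A quotient datum `(G, N, Φ)` for the action of `H` on `Γ` by automorphisms. -/
structure QuotientDatum (k Γ H : Type*) [Field k] [Group Γ] [Group H]
    [MulDistribMulAction H Γ] where
  /-- A subgroup of `H`. -/
  G : Subgroup H
  /-- A normal and `G`-stable subgroup of `Γ`. -/
  N : Subgroup Γ
  normal : N.Normal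
  stable : ∀ (g : G) {r : Γ}, r ∈ N → g • r ∈ N
  /-- The group morphism `Φ : N → (k^G)ˣ`. -/
  Φ : N →* (G → k)ˣ
  Φ_mul : ∀ (r : N) (l h : G),
    (Φ r : G → k) (l * h) = (Φ ⟨l⁻¹ • (r : Γ), stable l⁻¹ r.2⟩ : G → k) h * (Φ r : G → k) l
  Φ_conj : ∀ (r : N) (s : Γ), Φ r = Φ ⟨s * r * s⁻¹, normal.conj_mem r r.2 s⟩

namespace QuotientDatum

section

variable {k Γ H : Type*} [Field k] [Group Γ] [Group H] [MulDistribMulAction H Γ]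

instance instNormal (D : QuotientDatum k Γ H) : D.N.Normal := D.normal

/-- The action of `G` on `Γ/N` induced by the action of `H` on `Γ`: `l.u(r) = u(l.r)`. -/
def act (D : QuotientDatum k Γ H) (l : D.G) : Γ ⧸ D.N →* Γ ⧸ D.N :=
  QuotientGroup.map D.N D.N (MulDistribMulAction.toMonoidHom Γ l) fun _ hr => D.stable l hr

/-- A section `j` of the canonical projection `u : Γ → Γ/N` with `j(1) = 1`. -/
structure NormalizedSection (D : QuotientDatum k Γ H) where
  toFun : Γ ⧸ D.N → Γ
  mk_toFun : ∀ x, (toFun x : Γ ⧸ D.N) = x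
  map_one : toFun 1 = 1

instance (D : QuotientDatum k Γ H) : CoeFun D.NormalizedSection fun _ => Γ ⧸ D.N → Γ :=
  ⟨NormalizedSection.toFun⟩

/-- Normalized sections exist. -/
instance (D : QuotientDatum k Γ H) : Nonempty D.NormalizedSection := by
  classical
  refine ⟨⟨fun x => if x = 1 then 1 else x.out, fun x => ?_, if_pos rfl⟩⟩
  by_cases hx : x = 1
  · simp [hx]
  · simp [hx]

variable {D : QuotientDatum k Γ H}

theorem act_mk (l : D.G) (r : Γ) : D.act l (r : Γ ⧸ D.N) = ((l • r : Γ) : Γ ⧸ D.N) := rfl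

theorem mk_smul (j : D.NormalizedSection) (l : D.G) (x : Γ ⧸ D.N) :
    ((l • j x : Γ) : Γ ⧸ D.N) = D.act l x := by
  rw [← act_mk, j.mk_toFun]

theorem mem_mul (j : D.NormalizedSection) (x y : Γ ⧸ D.N) :
    j x * j y * (j (x * y))⁻¹ ∈ D.N := by
  rw [← QuotientGroup.eq_one_iff]
  simp [j.mk_toFun]

theorem mem_comul (j : D.NormalizedSection) (l : D.G) (x : Γ ⧸ D.N) :
    l • j x * (j (D.act l x))⁻¹ ∈ D.N := by
  rw [← QuotientGroup.eq_one_iff]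
  simp [j.mk_toFun, mk_smul]

theorem mem_antipode (j : D.NormalizedSection) (x : Γ ⧸ D.N) (h : D.G) :
    (j (D.act h⁻¹ x⁻¹))⁻¹ * h⁻¹ • (j x)⁻¹ ∈ D.N := by
  rw [← QuotientGroup.eq_one_iff]
  simp [j.mk_toFun, mk_smul, smul_inv']

/-- `Φ(j(x) j(y) j(xy)⁻¹)`, as a function on `G`. -/
def mulCoeff (j : D.NormalizedSection) (x y : Γ ⧸ D.N) : D.G → k :=
  (D.Φ ⟨_, mem_mul j x y⟩ : (D.G → k)ˣ)

/-- `Φ(l.j(x) j(l.x)⁻¹)`, as a function on `G`. -/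
def comulCoeff (j : D.NormalizedSection) (l : D.G) (x : Γ ⧸ D.N) : D.G → k :=
  (D.Φ ⟨_, mem_comul j l x⟩ : (D.G → k)ˣ)

/-- `Φ(j(h⁻¹.x⁻¹)⁻¹ h⁻¹.j(x)⁻¹)`, as a function on `G`. -/
def antipodeCoeff (j : D.NormalizedSection) (x : Γ ⧸ D.N) (h : D.G) : D.G → k :=
  (D.Φ ⟨_, mem_antipode j x h⟩ : (D.G → k)ˣ)

theorem Φ_eval_one (r : D.N) : (D.Φ r : D.G → k) 1 = 1 := by
  have h := D.Φ_mul r 1 1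
  have hu : IsUnit ((D.Φ r : D.G → k) 1) := (D.Φ r).isUnit.map (Pi.evalMonoidHom _ (1 : D.G))
  have e : (⟨(1 : D.G)⁻¹ • (r : Γ), D.stable (1 : D.G)⁻¹ r.2⟩ : D.N) = r := by
    ext; simp
  rw [e, mul_one] at h
  exact (mul_eq_left₀ hu.ne_zero).mp h.symm

theorem Φ_smul (r : Γ) (hr : r ∈ D.N) (l g : D.G) :
    (D.Φ ⟨r, hr⟩ : D.G → k) g =
      (D.Φ ⟨l • r, D.stable l hr⟩ : D.G → k) (l * g) * (D.Φ ⟨r, hr⟩ : D.G → k) l⁻¹ := by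
  have h := D.Φ_mul ⟨r, hr⟩ l⁻¹ (l * g)
  simpa using h

theorem Φ_congr {r s : Γ} (hr : r ∈ D.N) (h : r = s) (g : D.G) :
    (D.Φ ⟨r, hr⟩ : D.G → k) g = (D.Φ ⟨s, h ▸ hr⟩ : D.G → k) g := by
  subst h; rfl

theorem Φ_mul_apply {r s : Γ} (hr : r ∈ D.N) (hs : s ∈ D.N) (g : D.G) :
    (D.Φ ⟨r, hr⟩ : D.G → k) g * (D.Φ ⟨s, hs⟩ : D.G → k) g =
      (D.Φ ⟨r * s, mul_mem hr hs⟩ : D.G → k) g := by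
  rw [show (⟨r * s, mul_mem hr hs⟩ : D.N) = ⟨r, hr⟩ * ⟨s, hs⟩ from rfl, map_mul]
  rfl

theorem Φ_conj_apply {r : Γ} (hr : r ∈ D.N) (s : Γ) (g : D.G) :
    (D.Φ ⟨r, hr⟩ : D.G → k) g =
      (D.Φ ⟨s * r * s⁻¹, D.normal.conj_mem r hr s⟩ : D.G → k) g := by
  rw [D.Φ_conj ⟨r, hr⟩ s]

theorem Φ_one_apply {r : Γ} (hr : r ∈ D.N) (h : r = 1) (g : D.G) :
    (D.Φ ⟨r, hr⟩ : D.G → k) g = 1 := by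
  subst h
  rw [show (⟨1, hr⟩ : D.N) = 1 from rfl, map_one]
  rfl

theorem compat (j : D.NormalizedSection) : MonomialHopf.Compat D.act (mulCoeff j) (comulCoeff j)
    (fun x h => antipodeCoeff j x h h⁻¹) where
  one_smul x := by
    induction x using QuotientGroup.induction_on with
    | H r => simp [act_mk]
  mul_smul p m x := by
    induction x using QuotientGroup.induction_on with
    | H r => simp [act_mk, mul_smul]
  assoc x y z h := by
    unfold mulCoeff
    rw [Φ_conj_apply (mem_mul j y z) (j x), Φ_mul_apply, Φ_mul_apply]
    exact Φ_congr _ (by simp [mul_assoc]) _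
  one_left x h := Φ_one_apply _ (by simp [j.map_one]) _
  one_right x h := Φ_one_apply _ (by simp [j.map_one]) _
  coassoc p m x h := by
    unfold comulCoeff
    rw [Φ_smul _ (mem_comul j m x) p (m * h), ← mul_assoc, mul_right_comm, Φ_mul_apply]
    congr 1
    have e : D.act (p * m) x = D.act p (D.act m x) := by
      induction x using QuotientGroup.induction_on with
      | H r => simp [act_mk, mul_smul]
    exact Φ_congr _ (by simp [mul_smul, smul_mul', smul_inv', e, mul_assoc]) _
  one_act x h := by
    have e : D.act 1 x = x := by
      induction x using QuotientGroup.induction_on with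
      | H r => simp [act_mk]
    exact Φ_one_apply _ (by simp [e]) _
  eval_one l x := Φ_eval_one _
  act_one l h := Φ_one_apply _ (by simp [j.map_one]) _
  mul_eval_one x y := Φ_eval_one _
  compat l x y h := by
    unfold mulCoeff comulCoeff
    rw [Φ_smul _ (mem_mul j x y) l h, Φ_conj_apply (mem_comul j l y) (j (D.act l x)),
      mul_right_comm, Φ_mul_apply, Φ_mul_apply, mul_left_comm, Φ_mul_apply, mul_comm]
    congr 1
    exact Φ_congr _ (by simp [smul_mul', smul_inv', mul_assoc]) _
  antipode_left l x := by
    unfold mulCoeff comulCoeff antipodeCoeff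
    simp only [inv_inv]
    rw [Φ_conj_apply (mem_mul j (D.act l x⁻¹) (D.act l x)) (j (D.act l x⁻¹))⁻¹, mul_right_comm,
      Φ_mul_apply, Φ_mul_apply]
    refine Φ_one_apply _ ?_ _
    rw [← map_mul, inv_mul_cancel, map_one, j.map_one]
    simp [smul_inv', mul_assoc]
  antipode_right l x := by
    unfold mulCoeff comulCoeff antipodeCoeff
    have h1 : (D.Φ ⟨_, mem_comul j l x⟩ : D.G → k) l * (D.Φ ⟨_, D.stable l⁻¹ (mem_comul j l x)⟩ :
        D.G → k) l⁻¹ = 1 := by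
      have := D.Φ_mul ⟨_, mem_comul j l x⟩ l l⁻¹
      rw [mul_inv_cancel, Φ_eval_one] at this
      rw [mul_comm]
      exact this.symm
    rw [mul_assoc, mul_comm ((D.Φ ⟨_, mem_antipode j _ _⟩ : D.G → k) l⁻¹), Φ_mul_apply]
    refine Eq.trans ?_ h1
    congr 1
    have e : D.act l⁻¹ (D.act l x)⁻¹ = x⁻¹ := by
      induction x using QuotientGroup.induction_on with
      | H r =>
        rw [act_mk, ← QuotientGroup.mk_inv, act_mk]
        simp [smul_inv']
    refine Φ_congr _ ?_ _
    rw [e, mul_inv_cancel, j.map_one]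
    simp [smul_mul', smul_inv', mul_assoc]

end

/-- The underlying vector space of `k[Γ/N] ⋊_Φ k^G` is `k[Γ/N] ⊗ k^G`; its multiplication and
comultiplication are defined by means of a normalized section `j`. -/
def TwistedSmashCoproduct {k Γ H : Type*} [Field k] [Group Γ] [Group H] [MulDistribMulAction H Γ]
    (D : QuotientDatum k Γ H) (_j : D.NormalizedSection) : Type _ :=
  MonoidAlgebra k (Γ ⧸ D.N) ⊗[k] (D.G → k)

namespace TwistedSmashCoproduct

attribute [local instance] Fintype.ofFinite Classical.decEq

variable {k Γ H : Type*} [Field k] [Group Γ] [Group H] [MulDistribMulAction H Γ]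
  {D : QuotientDatum k Γ H} (j : D.NormalizedSection)

instance instAddCommGroup : AddCommGroup (D.TwistedSmashCoproduct j) :=
  inferInstanceAs (AddCommGroup (MonoidAlgebra k (Γ ⧸ D.N) ⊗[k] (D.G → k)))

instance : Module k (D.TwistedSmashCoproduct j) :=
  inferInstanceAs (Module k (MonoidAlgebra k (Γ ⧸ D.N) ⊗[k] (D.G → k)))

/-- The element `x # f = x ⊗ f`, for `x ∈ Γ/N` and `f ∈ k^G`. -/
def elt (x : Γ ⧸ D.N) (f : D.G → k) : D.TwistedSmashCoproduct j :=
  (MonoidAlgebra.single x (1 : k) ⊗ₜ[k] f : MonoidAlgebra k (Γ ⧸ D.N) ⊗[k] (D.G → k))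

/-- The function `δ_h`. -/
def delta (h : D.G) : D.G → k := Pi.single h 1

theorem elt_smul (x : Γ ⧸ D.N) (c : k) (f : D.G → k) : elt j x (c • f) = c • elt j x f :=
  TensorProduct.tmul_smul _ _ _

theorem elt_zero (x : Γ ⧸ D.N) : elt j x 0 = 0 := TensorProduct.tmul_zero _ _

theorem delta_mul (h : D.G) (f : D.G → k) : delta h * f = f h • delta h := by
  unfold delta
  ext g
  by_cases hg : g = h
  · subst hg; simp
  · simp [hg]

theorem delta_mul_delta (h g : D.G) :
    (delta h * delta g : D.G → k) = if h = g then delta h else 0 := by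
  rw [delta_mul]
  by_cases hg : h = g
  · subst hg; simp [delta]
  · simp [delta, hg]

variable [Finite H]

/-- The basis `(x # δ_h)` of `k[Γ/N] ⊗ k^G`. -/
def basis : Module.Basis ((Γ ⧸ D.N) × D.G) k (D.TwistedSmashCoproduct j) :=
  (MonoidAlgebra.basis (Γ ⧸ D.N) k).tensorProduct (Pi.basisFun k D.G)

theorem basis_apply (x : Γ ⧸ D.N) (h : D.G) : basis j (x, h) = elt j x (delta h) := by
  refine (Module.Basis.tensorProduct_apply _ _ _ _).trans ?_
  rw [MonoidAlgebra.basis_apply, Pi.basisFun_apply]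
  unfold elt delta
  congr!

/-- `(x # δ_h)(y # δ_g) = xy # δ_h δ_g Φ(j(x) j(y) j(xy)⁻¹)`. -/
def mul : D.TwistedSmashCoproduct j →ₗ[k] D.TwistedSmashCoproduct j →ₗ[k]
    D.TwistedSmashCoproduct j :=
  (basis j).constr k fun p => (basis j).constr k fun q =>
    elt j (p.1 * q.1) (delta p.2 * delta q.2 * mulCoeff j p.1 q.1)

/-- `Δ(x # δ_h) = ∑_l (x # δ_{l⁻¹}) ⊗ (l.x # δ_{lh} Φ(l.j(x) j(l.x)⁻¹))`. -/
def comul : D.TwistedSmashCoproduct j →ₗ[k]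
    D.TwistedSmashCoproduct j ⊗[k] D.TwistedSmashCoproduct j :=
  (basis j).constr k fun p => ∑ l : D.G,
    elt j p.1 (delta l⁻¹) ⊗ₜ[k] elt j (D.act l p.1) (delta (l * p.2) * comulCoeff j l p.1)

/-- `ε(x # δ_h) = δ_{h,1}`. -/
def counit : D.TwistedSmashCoproduct j →ₗ[k] k :=
  (basis j).constr k fun p => if p.2 = 1 then 1 else 0

/-- `S(x # δ_h) = h⁻¹.x⁻¹ # Φ(j(h⁻¹.x⁻¹)⁻¹ h⁻¹.j(x)⁻¹) δ_{h⁻¹}`. -/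
def antipode : D.TwistedSmashCoproduct j →ₗ[k] D.TwistedSmashCoproduct j :=
  (basis j).constr k fun p =>
    elt j (D.act p.2⁻¹ p.1⁻¹) (antipodeCoeff j p.1 p.2 * delta p.2⁻¹)

theorem mul_basis (x : Γ ⧸ D.N) (h : D.G) (y : Γ ⧸ D.N) (g : D.G) :
    mul j (basis j (x, h)) (basis j (y, g)) =
      if h = g then mulCoeff j x y h • basis j (x * y, h) else 0 := by
  simp only [mul, Module.Basis.constr_basis]
  rw [delta_mul_delta]
  split_ifs with hg
  · rw [delta_mul, elt_smul, basis_apply]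
  · rw [zero_mul, elt_zero]

theorem one_eq_sum : elt j 1 1 = ∑ h, basis j (1, h) := by
  simp only [basis_apply]
  unfold elt delta
  refine Eq.trans ?_ (TensorProduct.tmul_sum _ _ _)
  rw [Finset.univ_sum_single]
  rfl

/-- The multiplication is `mul` and the unit is `1 # 1`. -/
instance : Ring (D.TwistedSmashCoproduct j) :=
  { instAddCommGroup j with
    mul := fun a b => mul j a b
    one := elt j 1 1
    left_distrib := fun a b c => map_add (mul j a) b c
    right_distrib := fun a b c => LinearMap.map_add₂ (mul j) a b c
    zero_mul := fun a => LinearMap.map_zero₂ (mul j) a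
    mul_zero := fun a => map_zero (mul j a)
    mul_assoc := by
      exact MonomialHopf.mul_assoc_of_compat _ (compat j) (mul j) (mul_basis j)
    one_mul := by
      exact MonomialHopf.one_mul_of_compat _ (compat j) (mul j) (mul_basis j) _
        (one_eq_sum j)
    mul_one := by
      exact MonomialHopf.mul_one_of_compat _ (compat j) (mul j) (mul_basis j) _
        (one_eq_sum j) }

instance : Algebra k (D.TwistedSmashCoproduct j) :=
  Algebra.ofModule (fun c a b => LinearMap.map_smul₂ (mul j) c a b)
    (fun c a b => map_smul (mul j a) c b)

theorem comul_basis (x : Γ ⧸ D.N) (h : D.G) : comul j (basis j (x, h)) =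
    ∑ l : D.G, basis j (x, l⁻¹) ⊗ₜ[k]
      (comulCoeff j l x (l * h) • basis j (D.act l x, l * h)) := by
  rw [comul, Module.Basis.constr_basis]
  simp only [basis_apply, delta_mul, elt_smul]

theorem counit_basis (x : Γ ⧸ D.N) (h : D.G) :
    counit j (basis j (x, h)) = if h = 1 then 1 else 0 := by
  simp only [counit, Module.Basis.constr_basis]

theorem antipode_basis (x : Γ ⧸ D.N) (h : D.G) : antipode j (basis j (x, h)) =
    antipodeCoeff j x h h⁻¹ • basis j (D.act h⁻¹ x⁻¹, h⁻¹) := by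
  rw [antipode, Module.Basis.constr_basis]
  simp only [mul_comm (antipodeCoeff j x h), delta_mul, elt_smul, basis_apply]

instance : Coalgebra k (D.TwistedSmashCoproduct j) where
  comul := comul j
  counit := counit j
  coassoc := MonomialHopf.coassoc_of_compat _ (compat j) _ (comul_basis j)
  rTensor_counit_comp_comul := by
    exact MonomialHopf.rTensor_of_compat _ (compat j) _ _ (comul_basis j)
      (counit_basis j)
  lTensor_counit_comp_comul := by
    exact MonomialHopf.lTensor_of_compat _ (compat j) _ _ (comul_basis j)
      (counit_basis j)

instance : Bialgebra k (D.TwistedSmashCoproduct j) :=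
  Bialgebra.mk' k _
    (by
      change counit j (elt j 1 1) = 1
      simp [one_eq_sum, counit_basis])
    (by
      exact MonomialHopf.counit_mul_of_compat _ (compat j) _ (mul_basis j)
        (counit_basis j) _ _)
    (by
      exact MonomialHopf.comul_one_of_compat _ (compat j) _ (one_eq_sum j)
        (comul_basis j))
    (by
      exact MonomialHopf.comul_mul_of_compat _ (compat j) _ (mul_basis j)
        (comul_basis j) _ _)

instance : HopfAlgebra k (D.TwistedSmashCoproduct j) where
  antipode := antipode j
  mul_antipode_rTensor_comul := by
    exact MonomialHopf.antipode_left_of_compat _ (compat j) _ _ _ (one_eq_sum j)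
      (mul_basis j) (comul_basis j) (counit_basis j) (antipode_basis j)
  mul_antipode_lTensor_comul := by
    exact MonomialHopf.antipode_right_of_compat _ (compat j) _ _ _ (one_eq_sum j)
      (mul_basis j) (comul_basis j) (counit_basis j) (antipode_basis j)

end TwistedSmashCoproduct

end QuotientDatum

end

/-! Write `e_h` for the image of `1 # δ_h` in `L`. The set `G` of all `h` with `e_h ≠ 0` is closed
under products because `Δ(e_{pq}) (e_p ⊗ e_q) = e_p ⊗ e_q`, hence a subgroup as `H` is finite, and
`N` is the kernel of the action of `Γ` on `e_1`. Everything about `Φ` comes from the identity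
`Δ(π(r # δ_{pq})) (e_p ⊗ e_q) = π(r # δ_p) ⊗ π(p⁻¹.r # δ_q)`: for `r ∈ N` and `q = p⁻¹` its left
hand side is `e_p ⊗ e_{p⁻¹}`, so that `π(r # δ_p)` is a multiple `Φ(r)(p) e_p`, and for general `q`
it is the cocycle condition on `Φ`. Finally the vectors `π(j(x) # δ_h)` with `h ∈ G` span `L`, and
they are linearly independent because they are simultaneous eigenvectors of the operators
`a ↦ (f ⊗ id)(Δ(a) (e_1 ⊗ e_g))`, where `f ∈ L*`, with distinct systems of eigenvalues. -/

section LinearAlgebra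

theorem linearIndependent_of_simultaneous_eigenvectors {R M ι κ : Type*} [CommRing R] [IsDomain R]
    [AddCommGroup M] [Module R M] [Module.IsTorsionFree R M] (T : κ → Module.End R M)
    {χ : ι → κ → R} (hχ : Function.Injective χ) {v : ι → M} (hv : ∀ i, v i ≠ 0)
    (hT : ∀ i m, T m (v i) = χ i m • v i) : LinearIndependent R v := by
  rw [linearIndependent_iff']
  intro s
  induction s using Finset.cons_induction with
  | empty => simp
  | cons a s ha ih =>
    intro c hc
    have hs : ∀ b ∈ s, c b = 0 := by
      intro b hb
      obtain ⟨m, hm⟩ := Function.ne_iff.mp (hχ.ne (ne_of_mem_of_not_mem hb ha))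
      -- `T m - χ a m` kills the term of index `a` and rescales the term of `b` by a nonzero scalar.
      have hsum : ∑ i ∈ s, (c i * (χ i m - χ a m)) • v i = 0 := by
        simpa [hT, smul_smul, mul_comm, sub_smul, mul_sub, Finset.smul_sum] using
          congrArg (T m - algebraMap R (Module.End R M) (χ a m)) hc
      exact (mul_eq_zero.mp (ih _ hsum b hb)).resolve_right (sub_ne_zero.mpr hm)
    have hca : c a • v a = 0 := by
      rwa [Finset.sum_cons, Finset.sum_eq_zero fun i hi => by rw [hs i hi, zero_smul],
        add_zero] at hc
    simpa using ⟨(smul_eq_zero.mp hca).resolve_right (hv a), hs⟩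

theorem basis_constr_injective {R M N ι : Type*} [CommSemiring R] [AddCommMonoid M]
    [Module R M] [AddCommMonoid N] [Module R N] (b : Module.Basis ι R M) {v : ι → N}
    (hv : LinearIndependent R v) : Function.Injective (b.constr R v) := by
  have hconstr : ⇑(b.constr R v) = Finsupp.linearCombination R v ∘ b.repr :=
    funext fun x => (b.constr_apply R v x).trans (Finsupp.linearCombination_apply R _).symm
  rw [hconstr]
  exact Function.Injective.comp hv b.repr.injective

variable {k V W : Type*} [Field k] [AddCommGroup V] [Module k V] [AddCommGroup W] [Module k W]

theorem exists_eq_smul_of_tmul_eq_tmul {v v' : V} {w w' : W} (hw' : w' ≠ 0)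
    (h : v' ⊗ₜ[k] w' = v ⊗ₜ[k] w) : ∃ c : k, v' = c • v := by
  obtain ⟨f, hf⟩ := Module.Projective.exists_dual_ne_zero k hw'
  have hv : f w' • v' = f w • v := by
    simpa using congrArg (fun t => TensorProduct.rid k V (f.lTensor V t)) h
  exact ⟨(f w')⁻¹ * f w, by rw [mul_smul, ← hv, inv_smul_smul₀ hf]⟩

theorem tmul_ne_zero {v : V} {w : W} (hv : v ≠ 0) (hw : w ≠ 0) : v ⊗ₜ[k] w ≠ 0 := by
  intro h
  obtain ⟨c, hc⟩ := exists_eq_smul_of_tmul_eq_tmul (k := k) (v := 0) hw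
    (h.trans (TensorProduct.zero_tmul V w).symm)
  exact hv (hc.trans (smul_zero c))

theorem tmul_right_injective {v : V} (hv : v ≠ 0) :
    Function.Injective fun w : W => v ⊗ₜ[k] w := by
  intro w w' h
  by_contra hne
  refine tmul_ne_zero (k := k) hv (sub_ne_zero.mpr hne) ?_
  rw [TensorProduct.tmul_sub, sub_eq_zero]
  exact h

end LinearAlgebra

namespace SmashCoproduct

attribute [local instance] Fintype.ofFinite Classical.decEq

variable {k Γ H L : Type*} [Field k] [Group Γ] [Group H] [Finite H] [MulDistribMulAction H Γ]
  [Ring L] [Bialgebra k L] (π : SmashCoproduct k Γ H →ₐc[k] L)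

/-- The image `π(r # δ_h)` of a basis vector; the comments write `e_h` for `π(1 # δ_h)`. -/
noncomputable def basisImage (r : Γ) (h : H) : L := π (basis k Γ H (r, h))

theorem basisImage_mul_basisImage (r s : Γ) (h g : H) :
    basisImage π r h * basisImage π s g = if h = g then basisImage π (r * s) h else 0 := by
  simp only [basisImage, ← map_mul, basis_mul, one_smul, apply_ite π, map_zero]

theorem basisImage_mul (r s : Γ) (h : H) :
    basisImage π (r * s) h = basisImage π r h * basisImage π s h := by
  rw [basisImage_mul_basisImage, if_pos rfl]

theorem sum_basisImage_one : ∑ h : H, basisImage π 1 h = 1 := by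
  simp only [basisImage, ← map_sum, ← one_eq_sum, map_one]

theorem counit_basisImage (r : Γ) (h : H) :
    Coalgebra.counit (R := k) (basisImage π r h) = if h = 1 then 1 else 0 := by
  rw [basisImage, CoalgHomClass.counit_comp_apply]
  exact counit_basis r h

theorem comul_basisImage (r : Γ) (h : H) : Coalgebra.comul (R := k) (basisImage π r h) =
    ∑ l : H, basisImage π r l⁻¹ ⊗ₜ[k] basisImage π (l • r) (l * h) := by
  have hcomul : Coalgebra.comul (R := k) (basis k Γ H (r, h)) = _ := comul_basis r h
  rw [basisImage, ← CoalgHomClass.map_comp_comul_apply, hcomul]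
  simp [basisImage]

theorem comul_basisImage_mul_tmul_eq_ite (r : Γ) (h p q : H) :
    Coalgebra.comul (R := k) (basisImage π r h) * (basisImage π 1 p ⊗ₜ[k] basisImage π 1 q) =
      if h = p * q then basisImage π r p ⊗ₜ[k] basisImage π (p⁻¹ • r) q else 0 := by
  rw [comul_basisImage, Finset.sum_mul, Finset.sum_eq_single p⁻¹]
  · by_cases hpq : h = p * q
    · simp [hpq, ← basisImage_mul]
    · simp [hpq, basisImage_mul_basisImage, inv_mul_eq_iff_eq_mul]
  · intro l _ hl
    have hlp : l⁻¹ ≠ p := fun h => hl (inv_eq_iff_eq_inv.mp h)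
    simp [basisImage_mul_basisImage, hlp]
  · simp

theorem comul_basisImage_mul_tmul (r : Γ) (p q : H) :
    Coalgebra.comul (R := k) (basisImage π r (p * q)) *
        (basisImage π 1 p ⊗ₜ[k] basisImage π 1 q) =
      basisImage π r p ⊗ₜ[k] basisImage π (p⁻¹ • r) q := by
  rw [comul_basisImage_mul_tmul_eq_ite, if_pos rfl]

theorem basisImage_ne_zero {h : H} (hh : basisImage π 1 h ≠ 0) (r : Γ) : basisImage π r h ≠ 0 := by
  intro hr
  rw [← mul_inv_cancel r, basisImage_mul, hr, zero_mul] at hh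
  exact hh rfl

theorem basisImage_eq_zero {h : H} (hh : basisImage π 1 h = 0) (r : Γ) : basisImage π r h = 0 := by
  rw [← mul_one r, basisImage_mul, hh, mul_zero]

theorem basisImage_one_one_ne_zero : basisImage π 1 1 ≠ 0 := by
  intro h
  simpa [h] using counit_basisImage π 1 1

theorem basisImage_one_mul_ne_zero {p q : H} (hp : basisImage π 1 p ≠ 0)
    (hq : basisImage π 1 q ≠ 0) : basisImage π 1 (p * q) ≠ 0 := by
  intro h
  have hpq := comul_basisImage_mul_tmul π 1 p q
  rw [h, map_zero, zero_mul, smul_one] at hpq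
  exact tmul_ne_zero hp hq hpq.symm

section QuotientDatum

/-- The subgroup `G` of the quotient datum of `π`: the `h` such that `δ_h` is not killed. -/
def support : Subgroup H where
  carrier := {h | basisImage π 1 h ≠ 0}
  one_mem' := basisImage_one_one_ne_zero π
  mul_mem' := basisImage_one_mul_ne_zero π
  inv_mem' {h} hh := by
    let S : Submonoid H :=
      ⟨⟨{h | basisImage π 1 h ≠ 0}, basisImage_one_mul_ne_zero π⟩, basisImage_one_one_ne_zero π⟩
    have hinv : h⁻¹ ∈ Submonoid.powers h :=
      mem_powers_iff_mem_zpowers.mpr (inv_mem (Subgroup.mem_zpowers h))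
    exact Submonoid.powers_le.mpr (show h ∈ S from hh) hinv

theorem isIdempotentElem_basisImage_one (h : H) : IsIdempotentElem (basisImage π 1 h) := by
  rw [IsIdempotentElem, ← basisImage_mul, mul_one]

/-- The representation `r ↦ π(r # δ_1)` of `Γ` in the corner ring `e_1 L e_1`. -/
noncomputable def cornerHom : Γ →* (isIdempotentElem_basisImage_one π 1).Corner where
  toFun r := ⟨basisImage π r 1, (Subsemigroup.mem_corner_iff
    (isIdempotentElem_basisImage_one π 1)).mpr (by simp [← basisImage_mul])⟩
  map_one' := rfl
  map_mul' r s := Subtype.ext (basisImage_mul π r s 1)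

theorem cornerHom_eq_iff {r s : Γ} :
    cornerHom π r = cornerHom π s ↔ basisImage π r 1 = basisImage π s 1 :=
  Subtype.ext_iff

/-- The subgroup `N` of the quotient datum of `π`. -/
noncomputable def kernel : Subgroup Γ := (cornerHom π).ker

theorem mem_kernel {r : Γ} : r ∈ kernel π ↔ basisImage π r 1 = basisImage π 1 1 :=
  cornerHom_eq_iff π (s := 1)

theorem exists_basisImage_eq_smul {r : Γ} (hr : r ∈ kernel π) (p : support π) :
    ∃ c : k, basisImage π r p = c • basisImage π 1 p := by
  have htmul := comul_basisImage_mul_tmul π r p (p : H)⁻¹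
  rw [mul_inv_cancel, (mem_kernel π).mp hr, ← mul_inv_cancel (p : H), comul_basisImage_mul_tmul,
    smul_one] at htmul
  exact exists_eq_smul_of_tmul_eq_tmul (basisImage_ne_zero π (inv_mem p.2) _) htmul.symm

/-- The scalar `Φ(r)(p)` by which `r ∈ N` acts on `e_p`, where `p ∈ G`. -/
noncomputable def coeff (r : kernel π) (p : support π) : k :=
  (exists_basisImage_eq_smul π r.2 p).choose

theorem basisImage_eq_coeff_smul (r : kernel π) (p : support π) :
    basisImage π (r : Γ) (p : H) = coeff π r p • basisImage π 1 (p : H) :=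
  (exists_basisImage_eq_smul π r.2 p).choose_spec

theorem coeff_eq_of_basisImage_eq_smul {r : kernel π} {p : support π} {c : k}
    (hc : basisImage π (r : Γ) (p : H) = c • basisImage π 1 (p : H)) : coeff π r p = c :=
  smul_left_injective k p.2 ((basisImage_eq_coeff_smul π r p).symm.trans hc)

theorem basisImage_tmul_basisImage_inv_smul (r : kernel π) (p q : support π) :
    basisImage π (r : Γ) (p : H) ⊗ₜ[k] basisImage π ((p : H)⁻¹ • (r : Γ)) (q : H) =
      coeff π r (p * q) • (basisImage π 1 (p : H) ⊗ₜ[k] basisImage π 1 (q : H)) := by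
  have h := basisImage_eq_coeff_smul π r (p * q)
  rw [Subgroup.coe_mul] at h
  rw [← comul_basisImage_mul_tmul, h, map_smul, smul_mul_assoc, comul_basisImage_mul_tmul,
    smul_one]

theorem smul_mem_kernel (l : support π) {r : Γ} (hr : r ∈ kernel π) : l • r ∈ kernel π := by
  have h := basisImage_tmul_basisImage_inv_smul π ⟨r, hr⟩ l⁻¹ 1
  rw [mul_one, TensorProduct.smul_tmul', ← basisImage_eq_coeff_smul, Subgroup.coe_inv,
    inv_inv] at h
  exact (mem_kernel π).mpr (tmul_right_injective (basisImage_ne_zero π (inv_mem l.2) r) h)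

theorem coeff_mul_right (r : kernel π) (p q : support π) : coeff π r (p * q) =
    coeff π ⟨p⁻¹ • (r : Γ), smul_mem_kernel π p⁻¹ r.2⟩ q * coeff π r p := by
  have h := basisImage_tmul_basisImage_inv_smul π r p q
  have hq := basisImage_eq_coeff_smul π ⟨p⁻¹ • (r : Γ), smul_mem_kernel π p⁻¹ r.2⟩ q
  rw [basisImage_eq_coeff_smul π r p, show basisImage π ((p : H)⁻¹ • (r : Γ)) q = _ from hq,
    TensorProduct.tmul_smul, ← TensorProduct.smul_tmul', smul_smul] at h
  exact (smul_left_injective k (tmul_ne_zero p.2 q.2) h).symm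

theorem coeff_conj (r : kernel π) (s : Γ) (p : support π) :
    coeff π ⟨s * r * s⁻¹, (MonoidHom.normal_ker (cornerHom π)).conj_mem r r.2 s⟩ p =
      coeff π r p := by
  refine coeff_eq_of_basisImage_eq_smul π ?_
  rw [basisImage_mul, basisImage_mul, basisImage_eq_coeff_smul, mul_smul_comm, smul_mul_assoc,
    ← basisImage_mul, ← basisImage_mul, mul_one, mul_inv_cancel]

/-- The morphism `Φ : N → (k^G)ˣ` of the quotient datum of `π`. -/
noncomputable def coeffHom : kernel π →* (support π → k)ˣ :=
  MonoidHom.toHomUnits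
    { toFun := coeff π
      map_one' := funext fun _ => coeff_eq_of_basisImage_eq_smul π (one_smul k _).symm
      map_mul' := fun r s => funext fun p => coeff_eq_of_basisImage_eq_smul π <| by
        rw [Subgroup.coe_mul, basisImage_mul, basisImage_eq_coeff_smul π r,
          basisImage_eq_coeff_smul π s, smul_mul_smul_comm, ← basisImage_mul, mul_one,
          Pi.mul_apply] }

/-- The quotient datum `(G, N, Φ)` determined by `π`. -/
noncomputable def quotientDatum : QuotientDatum k Γ H where
  G := support π
  N := kernel π
  normal := MonoidHom.normal_ker _
  stable := smul_mem_kernel π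
  Φ := coeffHom π
  Φ_mul := coeff_mul_right π
  Φ_conj r s := Units.ext (funext fun p => (coeff_conj π r s p).symm)

end QuotientDatum

section Factorization

variable {π} {D : QuotientDatum k Γ H}

variable (π D) in
/-- The condition under which `π` induces a bialgebra map `k[Γ/N] ⋊_Φ k^G → L`, where
`D = (G, N, Φ)`. -/
structure FactorsThrough : Prop where
  eq_zero {h : H} : h ∉ D.G → basisImage π 1 h = 0
  eq_smul (n : D.N) (h : D.G) :
    basisImage π (n : Γ) (h : H) = (D.Φ n : D.G → k) h • basisImage π 1 (h : H)

variable (π) in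
theorem factorsThrough_quotientDatum : FactorsThrough π (quotientDatum π) where
  eq_zero := not_not.mp
  eq_smul := basisImage_eq_coeff_smul π

theorem FactorsThrough.basisImage_eq_smul (hD : FactorsThrough π D) {r s : Γ}
    (hrs : r * s⁻¹ ∈ D.N) (h : D.G) :
    basisImage π r (h : H) = (D.Φ ⟨r * s⁻¹, hrs⟩ : D.G → k) h • basisImage π s (h : H) := by
  calc
    basisImage π r (h : H) = basisImage π (r * s⁻¹) h * basisImage π s h := by
      rw [← basisImage_mul, inv_mul_cancel_right]
    _ = (D.Φ ⟨r * s⁻¹, hrs⟩ : D.G → k) h • basisImage π s h := by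
      rw [hD.eq_smul ⟨r * s⁻¹, hrs⟩ h, smul_mul_assoc, ← basisImage_mul, one_mul]

open QuotientDatum

variable (j : D.NormalizedSection)

variable (π) in
/-- The linear map `x # δ_h ↦ π(j(x) # δ_h)` from `k[Γ/N] ⋊_Φ k^G` to `L`. -/
noncomputable def sectionMap : D.TwistedSmashCoproduct j →ₗ[k] L :=
  (TwistedSmashCoproduct.basis j).constr k fun p => basisImage π (j p.1) p.2

theorem sectionMap_basis (x : Γ ⧸ D.N) (h : D.G) :
    sectionMap π j (TwistedSmashCoproduct.basis j (x, h)) = basisImage π (j x) h :=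
  Module.Basis.constr_basis _ _ _ _

theorem sectionMap_one (hD : FactorsThrough π D) : sectionMap π j 1 = 1 := by
  have hone : (1 : D.TwistedSmashCoproduct j) = _ := TwistedSmashCoproduct.one_eq_sum j
  rw [hone, map_sum, ← sum_basisImage_one π]
  refine Fintype.sum_of_injective Subtype.val Subtype.val_injective _ _ (fun h hh => ?_)
    fun h => ?_
  · exact hD.eq_zero fun hG => hh ⟨⟨h, hG⟩, rfl⟩
  · rw [sectionMap_basis, j.map_one]

theorem sectionMap_mul (hD : FactorsThrough π D) (u v : D.TwistedSmashCoproduct j) :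
    sectionMap π j (u * v) = sectionMap π j u * sectionMap π j v := by
  revert u v
  rw [LinearMap.map_mul_iff]
  refine (TwistedSmashCoproduct.basis j).ext fun ⟨x, h⟩ =>
    (TwistedSmashCoproduct.basis j).ext fun ⟨y, g⟩ => ?_
  have hmul : TwistedSmashCoproduct.basis j (x, h) * TwistedSmashCoproduct.basis j (y, g) = _ :=
    TwistedSmashCoproduct.mul_basis j x h y g
  simp only [LinearMap.compr₂_apply, LinearMap.compl₂_apply, LinearMap.comp_apply,
    LinearMap.mul_apply', hmul, sectionMap_basis, basisImage_mul_basisImage,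
    Subtype.coe_inj, apply_ite (sectionMap π j), map_zero, map_smul]
  rw [hD.basisImage_eq_smul (mem_mul j x y) h]
  rfl

theorem counit_comp_sectionMap :
    Coalgebra.counit ∘ₗ sectionMap π j = Coalgebra.counit (R := k) := by
  refine (TwistedSmashCoproduct.basis j).ext fun ⟨x, h⟩ => ?_
  have hcounit : Coalgebra.counit (R := k) (TwistedSmashCoproduct.basis j (x, h)) = _ :=
    TwistedSmashCoproduct.counit_basis j x h
  rw [LinearMap.comp_apply, sectionMap_basis, counit_basisImage, hcounit]
  simp only [OneMemClass.coe_eq_one]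

theorem map_sectionMap_comp_comul (hD : FactorsThrough π D) :
    TensorProduct.map (sectionMap π j) (sectionMap π j) ∘ₗ Coalgebra.comul =
      Coalgebra.comul ∘ₗ sectionMap π j := by
  refine (TwistedSmashCoproduct.basis j).ext fun ⟨x, h⟩ => ?_
  have hcomul : Coalgebra.comul (R := k) (TwistedSmashCoproduct.basis j (x, h)) = _ :=
    TwistedSmashCoproduct.comul_basis j x h
  rw [LinearMap.comp_apply, LinearMap.comp_apply, sectionMap_basis, comul_basisImage, hcomul,
    map_sum]
  refine Fintype.sum_of_injective Subtype.val Subtype.val_injective _ _ (fun l hl => ?_)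
    fun l => ?_
  · have hl' : l⁻¹ ∉ D.G := fun hG => hl ⟨⟨l, inv_mem_iff.mp hG⟩, rfl⟩
    rw [basisImage_eq_zero π (hD.eq_zero hl'), TensorProduct.zero_tmul]
  · rw [TensorProduct.map_tmul, map_smul, sectionMap_basis, sectionMap_basis]
    exact congrArg (basisImage π (j x) (l : H)⁻¹ ⊗ₜ[k] ·)
      (hD.basisImage_eq_smul (mem_comul j l x) (l * h)).symm

/-- The bialgebra map `x # δ_h ↦ π(j(x) # δ_h)` induced by `π`. -/
noncomputable def sectionBialgHom (hD : FactorsThrough π D) :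
    D.TwistedSmashCoproduct j →ₐc[k] L :=
  BialgHom.ofAlgHom (AlgHom.ofLinearMap (sectionMap π j) (sectionMap_one j hD)
    (sectionMap_mul j hD))
    (AlgHom.ext (LinearMap.congr_fun (counit_comp_sectionMap j)))
    (AlgHom.ext (LinearMap.congr_fun (map_sectionMap_comp_comul j hD)))

theorem basisImage_mem_range_sectionMap (hD : FactorsThrough π D) (r : Γ) (h : H) :
    basisImage π r h ∈ LinearMap.range (sectionMap π j) := by
  by_cases hh : h ∈ D.G
  · have hr : r * (j (r : Γ ⧸ D.N))⁻¹ ∈ D.N := by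
      rw [← QuotientGroup.eq_one_iff, QuotientGroup.mk_mul, QuotientGroup.mk_inv, j.mk_toFun,
        mul_inv_cancel]
    rw [hD.basisImage_eq_smul hr ⟨h, hh⟩, ← sectionMap_basis]
    exact Submodule.smul_mem _ _ (LinearMap.mem_range_self _ _)
  · rw [basisImage_eq_zero π (hD.eq_zero hh)]
    exact zero_mem _

theorem sectionMap_surjective (hD : FactorsThrough π D) (hπ : Function.Surjective π) :
    Function.Surjective (sectionMap π j) := by
  intro a
  obtain ⟨b, rfl⟩ := hπ a
  rw [← LinearMap.mem_range]
  induction b using MonomialHopf.basis_induction (basis k Γ H) with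
  | h0 => rw [map_zero]; exact zero_mem _
  | ha x y hx hy => rw [map_add]; exact add_mem hx hy
  | hs c x hx => rw [map_smul]; exact Submodule.smul_mem _ c hx
  | hb p => exact basisImage_mem_range_sectionMap j hD p.1 p.2

end Factorization

section LinearIndependence

/-- The operator `a ↦ (f ⊗ id)(Δ(a) (e_1 ⊗ e_g))` on `L`. -/
noncomputable def slice (f : Module.Dual k L) (g : H) : Module.End k L :=
  (TensorProduct.lid k L).toLinearMap ∘ₗ f.rTensor L ∘ₗ
    LinearMap.mulRight k (basisImage π 1 1 ⊗ₜ[k] basisImage π 1 g) ∘ₗ Coalgebra.comul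

theorem slice_basisImage (f : Module.Dual k L) (g : H) (r : Γ) (h : H) :
    slice π f g (basisImage π r h) =
      (if h = g then f (basisImage π r 1) else 0) • basisImage π r h := by
  simp only [slice, LinearMap.comp_apply, LinearMap.mulRight_apply,
    comul_basisImage_mul_tmul_eq_ite, one_mul, inv_one, one_smul]
  split_ifs with hg
  · simp [hg]
  · simp

theorem linearIndependent_basisImage {ι : Type*} {r : ι → Γ}
    (hr : Function.Injective fun i => basisImage π (r i) 1) :
    LinearIndependent k fun p : ι × support π => basisImage π (r p.1) p.2 := by
  refine linearIndependent_of_simultaneous_eigenvectors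
    (fun m : Module.Dual k L × H => slice π m.1 m.2)
    (χ := fun p m => if (p.2 : H) = m.2 then m.1 (basisImage π (r p.1) 1) else 0) ?_
    (fun p => basisImage_ne_zero π p.2.2 _) fun p m => slice_basisImage π m.1 m.2 _ _
  intro p q hpq
  have hf (f : Module.Dual k L) : f (basisImage π (r p.1) 1) =
      if (q.2 : H) = p.2 then f (basisImage π (r q.1) 1) else 0 := by
    simpa using congrFun hpq (f, (p.2 : H))
  by_cases hG : (q.2 : H) = p.2
  · simp only [hG, if_true] at hf
    refine Prod.ext (hr ?_) (Subtype.ext hG.symm)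
    refine sub_eq_zero.mp ((Module.forall_dual_apply_eq_zero_iff k _).mp fun f => ?_)
    rw [map_sub, hf, sub_self]
  · simp only [hG, if_false] at hf
    exact absurd ((Module.forall_dual_apply_eq_zero_iff k _).mp hf)
      (basisImage_ne_zero π (basisImage_one_one_ne_zero π) _)

theorem basisImage_section_injective (j : (quotientDatum π).NormalizedSection) :
    Function.Injective fun x => basisImage π (j x) 1 := by
  intro x y hxy
  rw [← j.mk_toFun x, ← j.mk_toFun y, QuotientGroup.eq]
  exact (MonoidHom.eq_iff _).mp ((cornerHom_eq_iff π).mpr hxy.symm)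

theorem sectionMap_quotientDatum_injective (j : (quotientDatum π).NormalizedSection) :
    Function.Injective (sectionMap π j) :=
  basis_constr_injective _ (linearIndependent_basisImage π (basisImage_section_injective π j))

end LinearIndependence

end SmashCoproduct

theorem theorem2p7_general {k Γ H L : Type*} [Field k] [Group Γ] [Group H] [Finite H]
    [MulDistribMulAction H Γ] [Ring L] [Bialgebra k L]
    (π : SmashCoproduct k Γ H →ₐc[k] L) (hπ : Function.Surjective π) :
    ∃ D : QuotientDatum k Γ H, ∀ j : D.NormalizedSection,
      Nonempty (L ≃ₐc[k] D.TwistedSmashCoproduct j) := by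
  have hD := SmashCoproduct.factorsThrough_quotientDatum π
  refine ⟨SmashCoproduct.quotientDatum π, fun j => ⟨(BialgEquiv.ofBijective
    (SmashCoproduct.sectionBialgHom j hD) ⟨?_, ?_⟩).symm⟩⟩
  · exact SmashCoproduct.sectionMap_quotientDatum_injective π j
  · exact SmashCoproduct.sectionMap_surjective j hD hπ

theorem theorem2p7 {k Γ H L : Type*} [Field k] [Group Γ] [Group H] [Finite H]
    [MulDistribMulAction H Γ] [Ring L] [HopfAlgebra k L]
    (π : SmashCoproduct k Γ H →ₐc[k] L) (hπ : Function.Surjective π) :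
    ∃ D : QuotientDatum k Γ H, ∀ j : D.NormalizedSection,
      Nonempty (L ≃ₐc[k] D.TwistedSmashCoproduct j) :=
  theorem2p7_general π hπ
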